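/- Let $d\ge 2$ be an integer, $p>1$ and $\alpha=(d+2p)^{-1}$. For $x,y\in\mathbb R^d$ and a finite set $A\subset\mathbb R^d$, consider the complete graph on $A\cup\{x,y\}$ in which the edge between $u$ and $v$ has weight $|u-v|^p$ (Euclidean norm). A shortest path from $x$ to $y$ through $A$ is a path in this graph, without repeated nodes, from $x$ to $y$ whose total edge weight is minimal. Let $z\in\mathbb R^d$ and $R_2>R_1>0$. Let $X_1,X_2,\dots$ be i.i.d. random points of $\mathbb R^d$ whose density $f$ is the uniform density on the open ball $B(z;R_2)$, that is, $f=1/\mathrm{vol}(B(z;R_2))$ on $B(z;R_2)$ and $f=0$ elsewhere. Let $x_n,y_n$ be sequences of (non-random) points of $B(z;R_1)$ with $\lim_{n\to\infty}(n f(z))^{\alpha}|x_n-y_n|=+\infty$. Let $\# L_n(x_n,y_n)$ denote the number of nodes, end points included, of the shortest path from $x_n$ to $y_n$ through $\{X_1,\dots,X_n\}$ (the maximal such number, should the shortest path not be unique). Then there exists a constant $C_*>0$ such that, if $G_n$ denotes the event $$\frac{\# L_n(x_n,y_n)}{(n f(z))^{1/d}\,|x_n-y_n|}\le C_*,$$ then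 $$\limsup_{n\to\infty}\frac{1}{(n f(z))^{\alpha}|x_n-y_n|}\,\log\bigl(1-\Pr(G_n)\bigr)<0,$$ where $\log 0=-\infty$. -/

import Mathlib

open MeasureTheory ProbabilityTheory Filter Metric

noncomputable section

/-- Power-weighted length of a graph path: the sum of `|u - v| ^ p` over its edges `u → v`.
The ambient graph `⊤` is the complete simple graph on all points of `E`. -/
def powerLength {E : Type*} [MetricSpace E] (p : ℝ) {x y : E}
    (w : (⊤ : SimpleGraph E).Walk x y) : ℝ :=
  (w.darts.map fun e => dist e.fst e.snd ^ p).sum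

/-- `w` is a graph path (no repeated nodes) from `x` to `y` all of whose nodes lie in
`A ∪ {x, y}`. -/
def IsPathThrough {E : Type*} [MetricSpace E] (A : Set E) {x y : E}
    (w : (⊤ : SimpleGraph E).Walk x y) : Prop :=
  w.IsPath ∧ ∀ u ∈ w.support, u ∈ A ∪ {x, y}

/-- `w` is a shortest path from `x` to `y` through `A ∪ {x, y}` for the edge weights
`|u - v| ^ p`. -/
def IsShortestPath {E : Type*} [MetricSpace E] (p : ℝ) (A : Set E) {x y : E}
    (w : (⊤ : SimpleGraph E).Walk x y) : Prop :=
  IsPathThrough A w ∧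
    ∀ w' : (⊤ : SimpleGraph E).Walk x y, IsPathThrough A w' → powerLength p w ≤ powerLength p w'

/-- The set of the first `n` sample points (the sequence is indexed from `0`). -/
def samplePoints {Ω E : Type*} (X : ℕ → Ω → E) (n : ℕ) (ω : Ω) : Set E :=
  {u | ∃ i < n, X i ω = u}

/-- The probability density of the uniform distribution on the open ball `B(z; R)`. -/
def uniformBallDensity {d : ℕ} (z : EuclideanSpace ℝ (Fin d)) (R : ℝ) :
    EuclideanSpace ℝ (Fin d) → ℝ :=
  (ball z R).indicator fun _ => (volume.real (ball z R))⁻¹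

end

/-! A cheap path is played off against a lower bound for all long ones. Let `D` be the ambient
dimension, `ρ = (n f(z))^(1/D)` and `s = ρ |x - y|`.

Lower bound (`measure_exists_chain_le`, `exists_forall_measure_exists_chain_le`): for independent
points, the mean of `exp(-θ · length)` of a chain is bounded one step at a time. With `θ = (τρ)^p`
each step contributes at most `e⁻²/n`. Markov's inequality and a union over at most `n^k` index
choices show that some chain of `k` points has length at most `k (τρ)^(-p)` with probability at most
`e^(-k)`.

Upper bound (`measure_not_reachableWithin_le`): cut the segment into `m = ⌈s⌉` pieces of length `h`
and surround it with `N^(D-1)` parallel columns of `m` disjoint balls. Hopping along nonempty balls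
of a column costs `h^p` times a sum over its runs of empty balls. Joint emptiness of cells decays
geometrically in their number, so the mean product of the gap sums is bounded as if columns were
independent, and all columns are expensive with probability at most `2^(-N^(D-1))`. The choice `N ~
m^(1/p)` is the widest affordable: reaching an outer column costs about `(hN)^p ~ h^p m`, the order
of travelling along it.

Outside these two events a shortest path has at most `K m` edges. The exponents are at least of
order `s^((D-1)/p)` and `s`, whereas `(n f(z))^α |x - y|` is at most a constant times `s^κ` with `κ
= Dα ≤ min(1, (D-1)/p)`. -/

/-! ### Walks, gap sums and travel along a column. -/

section Walks

variable {E : Type*} [MetricSpace E] {p : ℝ}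

lemma powerLength_cons {x y v : E} (h : (⊤ : SimpleGraph E).Adj x v)
    (w : (⊤ : SimpleGraph E).Walk v y) :
    powerLength p (SimpleGraph.Walk.cons h w) = dist x v ^ p + powerLength p w := by
  simp [powerLength]

lemma powerLength_append {x y v : E} (w : (⊤ : SimpleGraph E).Walk x v)
    (w' : (⊤ : SimpleGraph E).Walk v y) :
    powerLength p (w.append w') = powerLength p w + powerLength p w' := by
  simp [powerLength]

open Classical in
lemma powerLength_bypass_le {x y : E} (w : (⊤ : SimpleGraph E).Walk x y) :
    powerLength p w.bypass ≤ powerLength p w := by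
  refine (w.darts_bypass_sublist_darts.map _).sum_le_sum fun a ha => ?_
  obtain ⟨e, -, rfl⟩ := List.mem_map.1 ha
  positivity

/-- Erasing loops only drops nonnegative edge weights, so competitors may repeat nodes and be built
by concatenation. -/
lemma IsShortestPath.powerLength_le {A : Set E} {x y : E} {w : (⊤ : SimpleGraph E).Walk x y}
    (hw : IsShortestPath p A w) (w' : (⊤ : SimpleGraph E).Walk x y)
    (hw' : ∀ u ∈ w'.support, u ∈ A ∪ {x, y}) : powerLength p w ≤ powerLength p w' := by
  classical
  exact (hw.2 w'.bypass ⟨w'.bypass_isPath, fun u hu =>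
    hw' u (w'.support_bypass_subset_support hu)⟩).trans (powerLength_bypass_le w')

lemma powerLength_eq_sum_getVert {x y : E} (w : (⊤ : SimpleGraph E).Walk x y) :
    powerLength p w =
      ∑ i ∈ Finset.range w.length, dist (w.getVert i) (w.getVert (i + 1)) ^ p := by
  induction w with
  | nil => simp [powerLength]
  | cons h w ih =>
    rw [powerLength_cons, SimpleGraph.Walk.length_cons, Finset.sum_range_succ', ih,
      add_comm]
    simp

/-- There is a walk from `u` to `v` with nodes in `S` and power-weighted length at most `c`. -/
def ReachableWithin (p : ℝ) (S : Set E) (u v : E) (c : ℝ) : Prop :=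
  ∃ w : (⊤ : SimpleGraph E).Walk u v, (∀ a ∈ w.support, a ∈ S) ∧ powerLength p w ≤ c

lemma ReachableWithin.of_dist {S : Set E} {u v : E} {c : ℝ} (hu : u ∈ S) (hv : v ∈ S)
    (hc : dist u v ^ p ≤ c) : ReachableWithin p S u v c := by
  by_cases h : u = v
  · subst h
    refine ⟨.nil, by simpa using hu, ?_⟩
    have : 0 ≤ dist u u ^ p := by positivity
    simpa [powerLength] using this.trans hc
  · refine ⟨.cons (by simpa using h) .nil, ?_, ?_⟩
    · simp [hu, hv]
    · simpa [powerLength] using hc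

lemma ReachableWithin.trans {S : Set E} {u v a : E} {c c' : ℝ} (h : ReachableWithin p S u v c)
    (h' : ReachableWithin p S v a c') : ReachableWithin p S u a (c + c') := by
  obtain ⟨w, hw, hc⟩ := h
  obtain ⟨w', hw', hc'⟩ := h'
  refine ⟨w.append w', fun b hb => ?_, ?_⟩
  · rcases SimpleGraph.Walk.mem_support_append_iff _ _ |>.1 hb with hb | hb
    exacts [hw b hb, hw' b hb]
  · rw [powerLength_append]; exact add_le_add hc hc'

lemma ReachableWithin.mono {S : Set E} {u v : E} {c c' : ℝ} (h : ReachableWithin p S u v c)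
    (hc : c ≤ c') : ReachableWithin p S u v c' := by
  obtain ⟨w, hw, h⟩ := h
  exact ⟨w, hw, h.trans hc⟩

open Classical in
/-- The weight `(g + 2) ^ p` of the interval `[t - g, t)` if `Z` holds on all of it, else `0`. -/
noncomputable def gapTerm (p : ℝ) (Z : ℕ → Prop) (t g : ℕ) : ℝ :=
  if ∀ i, t ≤ i + g → i < t → Z i then ((g : ℝ) + 2) ^ p else 0

/-- The total weight of the intervals `[t - g, t)`, `g ≤ t ≤ m`, on which `Z` holds. -/
noncomputable def gapSum (p : ℝ) (Z : ℕ → Prop) (m : ℕ) : ℝ :=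
  ∑ t ∈ Finset.range (m + 1), ∑ g ∈ Finset.range (t + 1), gapTerm p Z t g

lemma gapTerm_nonneg (Z : ℕ → Prop) (t g : ℕ) : 0 ≤ gapTerm p Z t g := by
  unfold gapTerm; split_ifs <;> positivity

lemma rpow_add_le_two_rpow_mul {a b : ℝ} (ha : 0 ≤ a) (hb : 0 ≤ b) (hp : 0 ≤ p) :
    (a + b) ^ p ≤ 2 ^ p * (a ^ p + b ^ p) := by
  have h1 : a + b ≤ 2 * max a b := by
    linarith [le_max_left a b, le_max_right a b]
  have h2 : (max a b) ^ p ≤ a ^ p + b ^ p := by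
    have := Real.rpow_nonneg ha p
    have := Real.rpow_nonneg hb p
    rcases max_choice a b with h | h <;> rw [h] <;> linarith
  calc (a + b) ^ p ≤ (2 * max a b) ^ p := Real.rpow_le_rpow (by positivity) h1 hp
    _ = 2 ^ p * (max a b) ^ p := Real.mul_rpow (by norm_num) (by positivity)
    _ ≤ _ := by gcongr

lemma le_sum_gapTerm {Z : ℕ → Prop} {t g : ℕ} (hg : g ≤ t)
    (hZ : ∀ i, t ≤ i + g → i < t → Z i) :
    ((g : ℝ) + 2) ^ p ≤ ∑ g ∈ Finset.range (t + 1), gapTerm p Z t g := by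
  have : ((g : ℝ) + 2) ^ p = gapTerm p Z t g := by rw [gapTerm, if_pos hZ]
  rw [this]
  exact Finset.single_le_sum (f := fun g => gapTerm p Z t g)
    (fun g _ => gapTerm_nonneg Z t g) (Finset.mem_range.2 (by omega))

/-- A column of balls of radius `h / 2` with centres `c 0, …, c (m - 1)` lets one travel from
`x` to `y` through `A`, at a cost controlled by the runs of balls that `A` misses. -/
theorem reachableWithin_of_column {A : Set E} {x y : E} {c : ℕ → E} {h w : ℝ} {m : ℕ}
    (hp : 0 ≤ p) (hh : 0 ≤ h) (hw : 0 ≤ w)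
    (hc : ∀ i j, i ≤ j → dist (c i) (c j) ≤ h * (j - i))
    (hxc : ∀ i, dist x (c i) ≤ h * (w + i))
    (hcy : ∀ i < m, dist (c i) y ≤ h * (w + (m - i))) (hxy : dist x y ≤ h * m) :
    ReachableWithin p (A ∪ {x, y}) x y
      (2 ^ p * h ^ p * (2 * w ^ p + gapSum p (fun i => ∀ a ∈ A, a ∉ ball (c i) (h / 2)) m)) := by
  set Z : ℕ → Prop := fun i => ∀ a ∈ A, a ∉ ball (c i) (h / 2) with hZ
  set G : ℕ → ℝ := fun t => ∑ g ∈ Finset.range (t + 1), gapTerm p Z t g with hG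
  have hG0 : ∀ t, 0 ≤ G t := fun t => Finset.sum_nonneg fun g _ => gapTerm_nonneg Z t g
  set K : ℝ := 2 ^ p * h ^ p with hK
  have hK0 : 0 ≤ K := by positivity
  have hw0 : 0 ≤ w ^ p := by positivity
  -- Crossing `g` empty balls just before ball `t` is charged to `G t`, which contains the weight of
  -- that run. The `+ 2` covers one extra mesh step and the radii `h / 2`; `w` pays for the sideways
  -- move at either end.
  have jump : ∀ (u v : E) (t g : ℕ), dist u v ≤ h * (w + (g + 2)) → g ≤ t →
      (∀ i, t ≤ i + g → i < t → Z i) → dist u v ^ p ≤ K * (w ^ p + G t) := by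
    intro u v t g hd hg hz
    calc dist u v ^ p ≤ (h * (w + (g + 2))) ^ p := Real.rpow_le_rpow dist_nonneg hd hp
      _ = h ^ p * (w + (g + 2)) ^ p := Real.mul_rpow hh (by positivity)
      _ ≤ h ^ p * (2 ^ p * (w ^ p + ((g : ℝ) + 2) ^ p)) := by
          gcongr; exact rpow_add_le_two_rpow_mul hw (by positivity) hp
      _ ≤ h ^ p * (2 ^ p * (w ^ p + G t)) := by
          gcongr; exact le_sum_gapTerm hg hz
      _ = _ := by rw [hK]; ring
  have jump' : ∀ (u v : E) (t g : ℕ), dist u v ≤ h * (g + 2) → g ≤ t →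
      (∀ i, t ≤ i + g → i < t → Z i) → dist u v ^ p ≤ K * G t := by
    intro u v t g hd hg hz
    calc dist u v ^ p ≤ (h * (g + 2)) ^ p := Real.rpow_le_rpow dist_nonneg hd hp
      _ = h ^ p * ((g : ℝ) + 2) ^ p := Real.mul_rpow hh (by positivity)
      _ ≤ h ^ p * (2 ^ p * ((g : ℝ) + 2) ^ p) := by
          gcongr
          exact le_mul_of_one_le_left (by positivity) (Real.one_le_rpow (by norm_num) hp)
      _ ≤ h ^ p * (2 ^ p * G t) := by
          gcongr; exact le_sum_gapTerm hg hz
      _ = _ := by rw [hK]; ring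
  -- Greedy invariant: `r` is the last nonempty ball before `t`, and a sample point in it has been
  -- reached. Jumps are charged to distinct endpoints `s ≤ r`, so no term of the sum is used twice.
  have inv : ∀ t : ℕ, (∀ i < t, Z i) ∨ ∃ r < t, ∃ q ∈ A, q ∈ ball (c r) (h / 2) ∧
      (∀ i, r < i → i < t → Z i) ∧
      ReachableWithin p (A ∪ {x, y}) x q
        (K * (w ^ p + ∑ s ∈ Finset.range (r + 1), G s)) := by
    intro t
    induction t with
    | zero => left; simp
    | succ t ih =>
      by_cases hzt : Z t
      · rcases ih with ih | ⟨r, hr, q, hq, hqb, hz, hR⟩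
        · left
          intro i hi
          rcases Nat.lt_succ_iff_lt_or_eq.1 hi with hi | rfl
          exacts [ih i hi, hzt]
        · right
          refine ⟨r, by omega, q, hq, hqb, fun i h1 h2 => ?_, hR⟩
          rcases Nat.lt_succ_iff_lt_or_eq.1 h2 with hi | rfl
          exacts [hz i h1 hi, hzt]
      · right
        have : ∃ a ∈ A, a ∈ ball (c t) (h / 2) := by
          by_contra! hcon; exact hzt hcon
        obtain ⟨q', hq', hqb'⟩ := this
        refine ⟨t, by omega, q', hq', hqb', fun i h1 h2 => by omega, ?_⟩
        have hd' : dist (c t) q' ≤ h / 2 := by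
          rw [dist_comm]; exact (mem_ball.1 hqb').le
        rcases ih with ih | ⟨r, hr, q, hq, hqb, hz, hR⟩
        · refine (ReachableWithin.of_dist (by simp) (by simp [hq'])
            (jump x q' t t ?_ le_rfl fun i _ hi => ih i hi)).mono ?_
          · have := dist_triangle x (c t) q'
            have := hxc t
            nlinarith
          · gcongr
            exact Finset.single_le_sum (f := G) (fun s _ => hG0 s) (by simp)
        · refine (hR.trans (ReachableWithin.of_dist (by simp [hq]) (by simp [hq'])
            (jump' q q' t (t - r - 1) ?_ (by omega)
              fun i h1 h2 => hz i (by omega) h2))).mono ?_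
          · have h1 := dist_triangle4 q (c r) (c t) q'
            have h2 := hc r t hr.le
            have h3 := (mem_ball.1 hqb).le
            rw [Nat.cast_sub (by omega), Nat.cast_sub hr.le]
            push_cast
            nlinarith
          · rw [← mul_add, add_assoc]
            gcongr
            rw [Finset.sum_range_succ _ t]
            refine add_le_add (Finset.sum_le_sum_of_subset_of_nonneg
              (by intro s; simp only [Finset.mem_range]; omega) fun s _ _ => hG0 s) le_rfl
  -- The term `t = m` is kept apart to pay for the last jump to `y`.
  have hsum : gapSum p Z m = ∑ s ∈ Finset.range m, G s + G m := by
    rw [gapSum, Finset.sum_range_succ]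
  rw [hsum]
  rcases inv m with h0 | ⟨r, hr, q, hq, hqb, hz, hR⟩
  · refine ReachableWithin.of_dist (by simp) (by simp)
      ((jump x y m m ?_ le_rfl fun i _ hi => h0 i hi).trans ?_)
    · nlinarith
    · have : 0 ≤ ∑ s ∈ Finset.range m, G s := Finset.sum_nonneg fun s _ => hG0 s
      apply mul_le_mul_of_nonneg_left _ hK0
      linarith
  · refine (hR.trans (ReachableWithin.of_dist (by simp [hq]) (by simp)
      (jump q y m (m - r - 1) ?_ (by omega) fun i h1 h2 => hz i (by omega) h2))).mono ?_
    · have h1 := dist_triangle q (c r) y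
      have h2 := hcy r hr
      have h3 := (mem_ball.1 hqb).le
      rw [Nat.cast_sub (by omega), Nat.cast_sub hr.le]
      push_cast
      nlinarith
    · have : ∑ s ∈ Finset.range (r + 1), G s ≤ ∑ s ∈ Finset.range m, G s :=
        Finset.sum_le_sum_of_subset_of_nonneg
          (by intro s; simp only [Finset.mem_range]; omega) fun s _ _ => hG0 s
      rw [← mul_add]
      apply mul_le_mul_of_nonneg_left _ hK0
      linarith

/-- A path through `A` with more than `k + 1` nodes starts with `k` distinct points of `A`. -/
lemma IsPathThrough.exists_chain {A : Set E} {x y : E} {w : (⊤ : SimpleGraph E).Walk x y}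
    (hw : IsPathThrough A w) {k : ℕ} (hk : k < w.length) :
    ∃ u : ℕ → E, u 0 = x ∧ (∀ j, 1 ≤ j → j ≤ k → u j ∈ A) ∧ Set.InjOn u {j | j ≤ k} ∧
      ∑ j ∈ Finset.range k, dist (u j) (u (j + 1)) ^ p ≤ powerLength p w := by
  refine ⟨w.getVert, w.getVert_zero, fun j h1 h2 => ?_, fun i hi j hj hij => ?_, ?_⟩
  -- As `1 ≤ j ≤ k < w.length`, the node is neither endpoint of the path.
  · rcases hw.2 _ (w.getVert_mem_support j) with h | h | h
    · exact h
    · rw [hw.1.getVert_eq_start_iff (by omega)] at h; omega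
    · rw [Set.mem_singleton_iff, hw.1.getVert_eq_end_iff (by omega)] at h; omega
  · exact hw.1.getVert_injOn (by simp at hi ⊢; omega) (by simp at hj ⊢; omega) hij
  · rw [powerLength_eq_sum_getVert]
    exact Finset.sum_le_sum_of_subset_of_nonneg
      (by intro s; simp only [Finset.mem_range]; omega) fun s _ _ => by positivity

end Walks

/-! ### Exponential moments of chains of sample points. -/

section ChainMoment

open scoped ENNReal

/-- The points of a chain starting at `x` and then visiting `v 0, v 1, …`. -/
def chainFrom {E : Type*} {k : ℕ} (x : E) (v : Fin k → E) : Fin (k + 1) → E := Fin.cons x v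

lemma measurable_chainFrom {E : Type*} [MeasurableSpace E] {k : ℕ} (x : E) (i : Fin (k + 1)) :
    Measurable fun v : Fin k → E => chainFrom x v i := by
  refine Fin.cases ?_ (fun j => ?_) i
  · simp [chainFrom]
  · simpa [chainFrom] using measurable_pi_apply j

lemma measurable_chain_prod {E : Type*} [MeasurableSpace E] {g : E → E → ℝ≥0∞}
    (hg : Measurable (Function.uncurry g)) (k : ℕ) (x : E) :
    Measurable fun v : Fin k → E =>
      ∏ j : Fin k, g (chainFrom x v j.castSucc) (chainFrom x v j.succ) :=
  Finset.measurable_prod _ fun j _ => hg.comp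
    ((measurable_chainFrom x j.castSucc).prodMk (measurable_chainFrom x j.succ))

/-- The expected product of transition weights along a chain of independent points. -/
theorem lintegral_pi_chain_le {E : Type*} [MeasurableSpace E] (μ : Measure E) [SigmaFinite μ]
    {g : E → E → ℝ≥0∞} (hg : Measurable (Function.uncurry g)) {J : ℝ≥0∞}
    (hJ : ∀ u, ∫⁻ v, g u v ∂μ ≤ J) (k : ℕ) (x : E) :
    ∫⁻ v : Fin k → E, ∏ j : Fin k, g (chainFrom x v j.castSucc)
      (chainFrom x v j.succ) ∂(Measure.pi fun _ => μ) ≤ J ^ k := by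
  induction k generalizing x with
  | zero => simp
  | succ k ih =>
    have hmeas := fun (k : ℕ) (x : E) => measurable_chain_prod hg k x
    have mp := (measurePreserving_piFinSuccAbove (fun _ : Fin (k + 1) => μ) 0).symm
    rw [← mp.lintegral_comp (hmeas (k + 1) x)]
    -- Given the first visited point `a`, the rest is a chain from `a`; hence the induction over all
    -- starting points.
    refine (lintegral_prod_le _).trans ?_
    calc ∫⁻ a, ∫⁻ v : Fin k → E, _ ∂(Measure.pi fun _ => μ) ∂μ
        = ∫⁻ a, ∫⁻ v : Fin k → E, g x a *
            ∏ j : Fin k, g (chainFrom a v j.castSucc)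
              (chainFrom a v j.succ) ∂(Measure.pi fun _ => μ) ∂μ := by
          refine lintegral_congr fun a => lintegral_congr fun v => ?_
          have : (MeasurableEquiv.piFinSuccAbove (fun _ : Fin (k + 1) => E) 0).symm (a, v)
              = chainFrom a v := by
            simp [MeasurableEquiv.piFinSuccAbove, Fin.insertNthEquiv, chainFrom]
          rw [this, Fin.prod_univ_succ]
          rfl
      _ = ∫⁻ a, g x a * ∫⁻ v : Fin k → E,
            ∏ j : Fin k, g (chainFrom a v j.castSucc)
              (chainFrom a v j.succ) ∂(Measure.pi fun _ => μ) ∂μ := by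
          refine lintegral_congr fun a => ?_
          rw [lintegral_const_mul _ (hmeas k a)]
      _ ≤ ∫⁻ a, g x a * J ^ k ∂μ := lintegral_mono fun a => by gcongr; exact ih a
      _ = (∫⁻ a, g x a ∂μ) * J ^ k := by
          exact lintegral_mul_const _ (hg.comp (measurable_prodMk_left (x := x)))
      _ ≤ J ^ (k + 1) := by rw [pow_succ']; gcongr; exact hJ x

variable {Ω : Type*} [MeasurableSpace Ω] {P : Measure Ω} [IsProbabilityMeasure P]
  {E : Type*} [NormedAddCommGroup E] [MeasurableSpace E] [BorelSpace E]

/-- Exponential Markov bound for the power-weighted length of a chain of sample points. -/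
theorem measure_chain_le [SecondCountableTopology E] {X : ℕ → Ω → E} (hX : ∀ i, Measurable (X i)) (hind : iIndepFun X P)
    {μ : Measure E} (hlaw : ∀ i, P.map (X i) = μ) {p θ c : ℝ} (hθ : 0 ≤ θ) {J : ℝ≥0∞}
    (hJ : ∀ u : E, ∫⁻ v, ENNReal.ofReal (Real.exp (-(θ * dist u v ^ p))) ∂μ ≤ J)
    {k : ℕ} {ι : Fin k → ℕ} (hι : Function.Injective ι) (x : E) :
    P {ω | ∑ j : Fin k, dist (chainFrom x (fun i => X (ι i) ω) j.castSucc)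
      (chainFrom x (fun i => X (ι i) ω) j.succ) ^ p ≤ c}
      ≤ ENNReal.ofReal (Real.exp (θ * c)) * J ^ k := by
  have hμ : IsProbabilityMeasure μ := by
    rw [← hlaw 0]; exact Measure.isProbabilityMeasure_map (hX 0).aemeasurable
  set g : E → E → ℝ≥0∞ := fun u v => ENNReal.ofReal (Real.exp (-(θ * dist u v ^ p))) with hgdef
  have hg : Measurable (Function.uncurry g) := by
    simp only [hgdef, Function.uncurry_def]
    fun_prop
  set F : (Fin k → E) → ℝ≥0∞ := fun v =>
    ∏ j : Fin k, g (chainFrom x v j.castSucc)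
      (chainFrom x v j.succ) with hF
  have hFm : Measurable F := measurable_chain_prod hg k x
  have hYm : Measurable fun ω => fun i : Fin k => X (ι i) ω :=
    measurable_pi_lambda _ fun i => hX _
  have hmap : P.map (fun ω => fun i : Fin k => X (ι i) ω) = Measure.pi fun _ => μ := by
    rw [(iIndepFun_iff_map_fun_eq_pi_map fun i => (hX (ι i)).aemeasurable).1 (hind.precomp hι)]
    simp [hlaw]
  have hint : ∫⁻ ω, F (fun i => X (ι i) ω) ∂P ≤ J ^ k := by
    rw [← lintegral_map hFm hYm, hmap]
    exact lintegral_pi_chain_le μ hg hJ k x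
  -- Length at most `c` forces the product of the factors `exp (-θ * dist ^ p)` to be at least `exp
  -- (-θ * c)`; Markov's inequality then applies.
  calc _ ≤ P {ω | ENNReal.ofReal (Real.exp (-(θ * c))) ≤ F (fun i => X (ι i) ω)} := by
        refine measure_mono fun ω hω => ?_
        simp only [Set.mem_ofPred_eq, hF, hgdef] at hω ⊢
        rw [← ENNReal.ofReal_prod_of_nonneg fun _ _ => (Real.exp_pos _).le, ← Real.exp_sum]
        apply ENNReal.ofReal_le_ofReal
        rw [Real.exp_le_exp, Finset.sum_neg_distrib, ← Finset.mul_sum]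
        exact neg_le_neg (mul_le_mul_of_nonneg_left hω hθ)
    _ ≤ (∫⁻ ω, F (fun i => X (ι i) ω) ∂P) / ENNReal.ofReal (Real.exp (-(θ * c))) :=
        meas_ge_le_lintegral_div (hFm.comp hYm).aemeasurable
          (by simp [Real.exp_pos]) ENNReal.ofReal_ne_top
    _ ≤ J ^ k / ENNReal.ofReal (Real.exp (-(θ * c))) := by gcongr
    _ = _ := by
        rw [ENNReal.div_eq_inv_mul, ← ENNReal.ofReal_inv_of_pos (Real.exp_pos _), ← Real.exp_neg,
          neg_neg]

/-- Union bound: some chain of `k` distinct sample points starting at `x` is short. -/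
theorem measure_exists_chain_le [SecondCountableTopology E] {X : ℕ → Ω → E} (hX : ∀ i, Measurable (X i))
    (hind : iIndepFun X P) {μ : Measure E} (hlaw : ∀ i, P.map (X i) = μ) {p θ c : ℝ}
    (hθ : 0 ≤ θ) {J : ℝ≥0∞}
    (hJ : ∀ u : E, ∫⁻ v, ENNReal.ofReal (Real.exp (-(θ * dist u v ^ p))) ∂μ ≤ J)
    (n k : ℕ) (x : E) :
    P {ω | ∃ u : ℕ → E, u 0 = x ∧ (∀ j, 1 ≤ j → j ≤ k → u j ∈ samplePoints X n ω) ∧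
      Set.InjOn u {j | j ≤ k} ∧ ∑ j ∈ Finset.range k, dist (u j) (u (j + 1)) ^ p ≤ c}
      ≤ ENNReal.ofReal (Real.exp (θ * c)) * (n * J) ^ k := by
  classical
  -- Distinct points have distinct indices, so injective choices suffice, and these select
  -- independent points.
  set S : Finset (Fin k → Fin n) := Finset.univ.filter Function.Injective
  calc _ ≤ P (⋃ ι ∈ S, {ω | ∑ j : Fin k,
          dist (chainFrom x (fun i => X (ι i) ω) j.castSucc)
            (chainFrom x (fun i => X (ι i) ω) j.succ) ^ p ≤ c}) := by
        refine measure_mono ?_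
        rintro ω ⟨u, hu0, huA, hinj, hsum⟩
        have hex : ∀ j : Fin k, ∃ i : Fin n, X i ω = u (j + 1) := by
          intro j
          obtain ⟨i, hi, h⟩ := huA (j + 1) (by omega) (by omega)
          exact ⟨⟨i, hi⟩, h⟩
        choose ι hι using hex
        have hcons : ∀ j : Fin (k + 1),
            chainFrom x (fun i => X (ι i) ω) j = u j := by
          intro j
          refine Fin.cases ?_ (fun j => ?_) j
          · simp [hu0, chainFrom]
          · simp [hι, chainFrom]
        simp only [Set.mem_iUnion, Set.mem_ofPred_eq]
        refine ⟨ι, ?_, ?_⟩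
        · simp only [S, Finset.mem_filter, Finset.mem_univ, true_and]
          intro a b hab
          have h1 : u (a + 1) = u (b + 1) := by rw [← hι, ← hι, hab]
          have h2 := hinj (by simp) (by simp) h1
          exact Fin.ext (by omega)
        · simp only [hcons]
          rw [← Fin.sum_univ_eq_sum_range (fun j => dist (u j) (u (j + 1)) ^ p)] at hsum
          simpa using hsum
    _ ≤ ∑ ι ∈ S, P {ω | ∑ j : Fin k,
          dist (chainFrom x (fun i => X (ι i) ω) j.castSucc)
            (chainFrom x (fun i => X (ι i) ω) j.succ) ^ p ≤ c} :=
        measure_biUnion_finset_le _ _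
    _ ≤ ∑ ι ∈ S, ENNReal.ofReal (Real.exp (θ * c)) * J ^ k := by
        refine Finset.sum_le_sum fun ι hι => ?_
        exact measure_chain_le hX hind hlaw hθ hJ (ι := fun i => (ι i : ℕ))
          (Fin.val_injective.comp (Finset.mem_filter.1 hι).2) x
    _ ≤ (n : ℝ≥0∞) ^ k * (ENNReal.ofReal (Real.exp (θ * c)) * J ^ k) := by
        rw [Finset.sum_const, nsmul_eq_mul]
        gcongr
        have : S.card ≤ n ^ k := by
          simpa using Finset.card_le_univ S
        exact_mod_cast this
    _ = _ := by rw [mul_pow]; ring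

/-- From `t ≤ 1 + t ^ p` and `(1 + t) ^ N / N! ≤ exp (1 + t)`. It reduces integrability to that of a
negative power of `1 + ‖v‖`. -/
lemma exp_neg_rpow_le {t p : ℝ} (ht : 0 ≤ t) (hp : 1 ≤ p) (N : ℕ) :
    Real.exp (-t ^ p) ≤ Real.exp 2 * N.factorial * (1 + t) ^ (-(N : ℝ)) := by
  have h1 : t ≤ 1 + t ^ p := by
    rcases le_total t 1 with h | h
    · have : 0 ≤ t ^ p := by positivity
      linarith
    · have := Real.rpow_le_rpow_of_exponent_le h hp
      rw [Real.rpow_one] at this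
      linarith
  have h2 := Real.pow_div_factorial_le_exp (1 + t) (by linarith) N
  rw [Real.rpow_neg (by linarith), Real.rpow_natCast]
  have h3 : 0 < (1 + t) ^ N := by positivity
  have h4 : (0 : ℝ) < N.factorial := by positivity
  calc Real.exp (-t ^ p) ≤ Real.exp (2 - (1 + t)) := Real.exp_le_exp.2 (by linarith)
    _ = Real.exp 2 * (Real.exp (1 + t))⁻¹ := by rw [Real.exp_sub, div_eq_mul_inv]
    _ ≤ Real.exp 2 * ((1 + t) ^ N / N.factorial)⁻¹ := by gcongr
    _ = _ := by rw [inv_div]; ring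

variable [InnerProductSpace ℝ E] [FiniteDimensional ℝ E]

lemma lintegral_exp_neg_norm_rpow_lt_top (μ : Measure E) [μ.IsAddHaarMeasure] {p : ℝ}
    (hp : 1 ≤ p) : ∫⁻ v : E, ENNReal.ofReal (Real.exp (-‖v‖ ^ p)) ∂μ < ∞ := by
  set N : ℕ := Module.finrank ℝ E + 1
  have hI := finite_integral_one_add_norm (μ := μ) (E := E) (r := N) (by simp [N])
  calc _ ≤ ∫⁻ v : E, ENNReal.ofReal (Real.exp 2 * N.factorial) *
        ENNReal.ofReal ((1 + ‖v‖) ^ (-(N : ℝ))) ∂μ := by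
        refine lintegral_mono fun v => ?_
        rw [← ENNReal.ofReal_mul (by positivity)]
        exact ENNReal.ofReal_le_ofReal (exp_neg_rpow_le (norm_nonneg v) hp N)
    _ = ENNReal.ofReal (Real.exp 2 * N.factorial) *
        ∫⁻ v : E, ENNReal.ofReal ((1 + ‖v‖) ^ (-(N : ℝ))) ∂μ := by
        rw [lintegral_const_mul' _ _ ENNReal.ofReal_ne_top]
    _ < ∞ := ENNReal.mul_lt_top ENNReal.ofReal_lt_top hI

/-- Substitute `σ • (u - v)`. The Jacobian is what cancels `n f(z)` when `σ` is proportional to `ρ`.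
-/
lemma lintegral_exp_neg_dist_rpow_eq (μ : Measure E) [μ.IsAddHaarMeasure] {p σ : ℝ}
    (hσ : 0 < σ) (u : E) :
    ∫⁻ v : E, ENNReal.ofReal (Real.exp (-(σ ^ p * dist u v ^ p))) ∂μ =
      ENNReal.ofReal ((σ ^ Module.finrank ℝ E)⁻¹) *
        ∫⁻ v : E, ENNReal.ofReal (Real.exp (-‖v‖ ^ p)) ∂μ := by
  have hm : Measurable fun v : E => ENNReal.ofReal (Real.exp (-‖v‖ ^ p)) := by fun_prop
  have hm2 : Measurable fun v : E => σ • v := measurable_const_smul σ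
  have h1 : ∀ v : E, ENNReal.ofReal (Real.exp (-(σ ^ p * dist u v ^ p))) =
      (fun v : E => ENNReal.ofReal (Real.exp (-‖σ • v‖ ^ p))) (u - v) := by
    intro v
    simp only
    rw [norm_smul, Real.mul_rpow (norm_nonneg _) (norm_nonneg _), Real.norm_eq_abs,
      abs_of_pos hσ, dist_eq_norm]
  simp_rw [h1]
  rw [lintegral_sub_left_eq_self (fun v : E => ENNReal.ofReal (Real.exp (-‖σ • v‖ ^ p))) u,
    ← lintegral_map (f := fun v : E => ENNReal.ofReal (Real.exp (-‖v‖ ^ p))) hm hm2,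
    Measure.map_addHaar_smul μ hσ.ne', lintegral_smul_measure, smul_eq_mul,
    abs_of_pos (by positivity)]

end ChainMoment

/-! ### Empty cells and the mean product of gap sums. -/

section EmptyCells

open scoped ENNReal

variable {Ω : Type*} [MeasurableSpace Ω] {P : Measure Ω}

/-- The probability that `n` independent points all miss a given family of disjoint cells. -/
theorem measure_cells_empty_le [IsProbabilityMeasure P] {E κ : Type*} [MeasurableSpace E] {X : ℕ → Ω → E}
    (hX : ∀ i, Measurable (X i)) (hind : iIndepFun X P) {μ : Measure E}
    (hlaw : ∀ i, P.map (X i) = μ) {B : κ → Set E} (hB : ∀ c, MeasurableSet (B c)) {q : ℝ}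
    (hq : 0 ≤ q) (S : Finset κ) (hdisj : (S : Set κ).PairwiseDisjoint B)
    (hμ : ∀ c ∈ S, ENNReal.ofReal q ≤ μ (B c)) (n : ℕ) :
    P {ω | ∀ c ∈ S, ∀ a ∈ samplePoints X n ω, a ∉ B c}
      ≤ ENNReal.ofReal (Real.exp (-(n * q))) ^ S.card := by
  have hμp : IsProbabilityMeasure μ := by
    rw [← hlaw 0]; exact Measure.isProbabilityMeasure_map (hX 0).aemeasurable
  -- All cells are empty exactly when every point misses their union, of mass at least `|S| q` by
  -- disjointness; then `1 - t ≤ exp (-t)`.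
  set U : Set E := ⋃ c ∈ S, B c with hU
  have hUm : MeasurableSet U := S.measurableSet_biUnion fun c _ => hB c
  have hset : {ω | ∀ c ∈ S, ∀ a ∈ samplePoints X n ω, a ∉ B c} =
      ⋂ i ∈ Finset.range n, X i ⁻¹' Uᶜ := by
    ext ω
    simp only [samplePoints, Set.mem_ofPred_eq, forall_exists_index, and_imp, Set.mem_iInter,
      Finset.mem_range, Set.mem_preimage, Set.mem_compl_iff, hU, Set.mem_iUnion, not_exists]
    constructor
    · intro h i hi c hc
      exact h c hc _ i hi rfl
    · rintro h c hc _ i hi rfl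
      exact h i hi c hc
  have hUq : ENNReal.ofReal (S.card * q) ≤ μ U := by
    rw [hU, measure_biUnion_finset hdisj fun c _ => hB c, ENNReal.ofReal_mul (by positivity),
      ENNReal.ofReal_natCast, ← nsmul_eq_mul, ← Finset.sum_const]
    exact Finset.sum_le_sum hμ
  have hone : μ Uᶜ ≤ ENNReal.ofReal (Real.exp (-(S.card * q))) := by
    rw [prob_compl_eq_one_sub hUm]
    calc 1 - μ U ≤ 1 - ENNReal.ofReal (S.card * q) := tsub_le_tsub_left hUq _
      _ = ENNReal.ofReal (1 - S.card * q) := by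
          rw [ENNReal.ofReal_sub _ (by positivity), ENNReal.ofReal_one]
      _ ≤ _ := ENNReal.ofReal_le_ofReal (by
          have := Real.add_one_le_exp (-(S.card * q)); linarith)
  rw [hset, hind.measure_inter_preimage_eq_mul _ fun i _ => hUm.compl]
  calc ∏ i ∈ Finset.range n, P (X i ⁻¹' Uᶜ)
      = ∏ i ∈ Finset.range n, μ Uᶜ := Finset.prod_congr rfl fun i _ => by
        rw [← hlaw i, Measure.map_apply (hX i) hUm.compl]
    _ ≤ ∏ i ∈ Finset.range n, ENNReal.ofReal (Real.exp (-(S.card * q))) :=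
        Finset.prod_le_prod' fun _ _ => hone
    _ = _ := by
        rw [Finset.prod_const, Finset.card_range, ← ENNReal.ofReal_pow (Real.exp_pos _).le,
          ← ENNReal.ofReal_pow (Real.exp_pos _).le, ← Real.exp_nat_mul, ← Real.exp_nat_mul]
        congr 2
        ring

/-- If joint emptiness of any set of cells is exponentially unlikely in its size, then it is
exponentially unlikely in the number of columns that all columns have a large gap sum. -/
theorem measure_forall_gapSum_lt_le {J : Type*} [Fintype J] {Z : J → ℕ → Set Ω}
    (hZm : ∀ j i, MeasurableSet (Z j i)) {m : ℕ} {δ : ℝ} (hδ : 0 ≤ δ)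
    (hZ : ∀ S : Finset (J × ℕ), (∀ c ∈ S, c.2 < m) →
      P (⋂ c ∈ S, Z c.1 c.2) ≤ ENNReal.ofReal δ ^ S.card)
    {p A L : ℝ} (hL : 0 < L)
    (hA : ∀ t : ℕ, ∑ g ∈ Finset.range t, ((g : ℝ) + 2) ^ p * δ ^ g ≤ A) :
    P {ω | ∀ j, L < gapSum p (fun i => ω ∈ Z j i) m}
      ≤ ENNReal.ofReal ((m + 1) * A / L) ^ Fintype.card J := by
  classical
  have hA0 : 0 ≤ A := by simpa using hA 0
  set I : Finset (Σ _ : ℕ, ℕ) := (Finset.range (m + 1)).sigma fun t => Finset.range (t + 1)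
    with hI
  set T : J → (Σ _ : ℕ, ℕ) → Set Ω := fun j s =>
    {ω | ∀ i, s.1 ≤ i + s.2 → i < s.1 → ω ∈ Z j i} with hT
  have hTm : ∀ j s, MeasurableSet (T j s) := by
    intro j s
    simp only [hT, Set.ofPred_forall]
    exact MeasurableSet.iInter fun i => MeasurableSet.iInter fun _ =>
      MeasurableSet.iInter fun _ => hZm j i
  have hgap : ∀ j ω, ENNReal.ofReal (gapSum p (fun i => ω ∈ Z j i) m) =
      ∑ s ∈ I, ENNReal.ofReal (((s.2 : ℝ) + 2) ^ p) * (T j s).indicator 1 ω := by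
    intro j ω
    rw [gapSum, Finset.sum_sigma', ENNReal.ofReal_sum_of_nonneg fun s _ => gapTerm_nonneg _ _ _]
    refine Finset.sum_congr rfl fun s _ => ?_
    by_cases h : ω ∈ T j s
    · rw [Set.indicator_of_mem h, gapTerm,
        if_pos (show ∀ i, s.1 ≤ i + s.2 → i < s.1 → ω ∈ Z j i from h)]; simp
    · rw [Set.indicator_of_notMem h, gapTerm,
        if_neg (show ¬ ∀ i, s.1 ≤ i + s.2 → i < s.1 → ω ∈ Z j i from h)]; simp
  -- `φ` picks one run per column. Runs in different columns share no cell, so their lengths add up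
  -- and the bound `δ ^ |S|` factors over columns.
  have hprob : ∀ φ ∈ Fintype.piFinset fun _ : J => I,
      P (⋂ j, T j (φ j)) ≤ ∏ j, ENNReal.ofReal δ ^ (φ j).2 := by
    intro φ hφ
    have hφ' : ∀ j, (φ j).1 ≤ m ∧ (φ j).2 ≤ (φ j).1 := by
      intro j
      have := (Fintype.mem_piFinset.1 hφ) j
      simp only [hI, Finset.mem_sigma, Finset.mem_range] at this
      omega
    set S : Finset (J × ℕ) := (Finset.univ.sigma fun j =>
      Finset.Ico ((φ j).1 - (φ j).2) (φ j).1).map (Equiv.sigmaEquivProd J ℕ).toEmbedding with hS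
    have hmem : ∀ c : J × ℕ, c ∈ S ↔ (φ c.1).1 - (φ c.1).2 ≤ c.2 ∧ c.2 < (φ c.1).1 := by
      rintro ⟨j, i⟩
      simp [hS, Finset.mem_map_equiv]
    have hcard : S.card = ∑ j, (φ j).2 := by
      rw [hS, Finset.card_map, Finset.card_sigma]
      refine Finset.sum_congr rfl fun j _ => ?_
      rw [Nat.card_Ico]
      have := hφ' j
      omega
    rw [Finset.prod_pow_eq_pow_sum, ← hcard]
    refine (measure_mono ?_).trans (hZ S fun c hc => ?_)
    · intro ω hω
      simp only [Set.mem_iInter] at hω ⊢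
      intro c hc
      have h1 := (hmem c).1 hc
      exact hω c.1 c.2 (by omega) h1.2
    · have h1 := (hmem c).1 hc
      have h2 := hφ' c.1
      omega
  -- Expand the product of sums, bound each joint probability, and fold back. The factor `m + 1`
  -- counts the endpoints `t`.
  have hint : ∫⁻ ω, ∏ j, ENNReal.ofReal (gapSum p (fun i => ω ∈ Z j i) m) ∂P
      ≤ ENNReal.ofReal ((m + 1) * A) ^ Fintype.card J := by
    calc ∫⁻ ω, ∏ j, ENNReal.ofReal (gapSum p (fun i => ω ∈ Z j i) m) ∂P
        = ∫⁻ ω, ∑ φ ∈ Fintype.piFinset fun _ : J => I,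
            (∏ j, ENNReal.ofReal ((((φ j).2 : ℝ) + 2) ^ p)) *
              (⋂ j, T j (φ j)).indicator 1 ω ∂P := by
          refine lintegral_congr fun ω => ?_
          simp_rw [hgap]
          rw [Finset.prod_univ_sum]
          refine Finset.sum_congr rfl fun φ _ => ?_
          rw [Finset.prod_mul_distrib]
          congr 1
          by_cases h : ω ∈ ⋂ j, T j (φ j)
          · rw [Set.indicator_of_mem h]
            rw [Set.mem_iInter] at h
            simp [Set.indicator_of_mem (h _)]
          · rw [Set.indicator_of_notMem h]
            rw [Set.mem_iInter, not_forall] at h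
            obtain ⟨j, hj⟩ := h
            exact Finset.prod_eq_zero (Finset.mem_univ j) (Set.indicator_of_notMem hj _)
      _ = ∑ φ ∈ Fintype.piFinset fun _ : J => I,
            (∏ j, ENNReal.ofReal ((((φ j).2 : ℝ) + 2) ^ p)) * P (⋂ j, T j (φ j)) := by
          have hTI : ∀ φ : J → Σ _ : ℕ, ℕ, MeasurableSet (⋂ j, T j (φ j)) := fun φ =>
            MeasurableSet.iInter fun j => hTm j _
          rw [lintegral_finsetSum _ fun φ _ =>
            (measurable_one.indicator (hTI φ)).const_mul _]
          refine Finset.sum_congr rfl fun φ _ => ?_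
          rw [lintegral_const_mul _ (measurable_one.indicator (hTI φ)),
            lintegral_indicator_one (hTI φ)]
      _ ≤ ∑ φ ∈ Fintype.piFinset fun _ : J => I,
            ∏ j, ENNReal.ofReal ((((φ j).2 : ℝ) + 2) ^ p * δ ^ (φ j).2) := by
          refine Finset.sum_le_sum fun φ hφ => ?_
          calc _ ≤ (∏ j, ENNReal.ofReal ((((φ j).2 : ℝ) + 2) ^ p)) *
                ∏ j, ENNReal.ofReal δ ^ (φ j).2 := by gcongr; exact hprob φ hφ
            _ = _ := by
                rw [← Finset.prod_mul_distrib]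
                refine Finset.prod_congr rfl fun j _ => ?_
                rw [ENNReal.ofReal_mul (by positivity), ENNReal.ofReal_pow hδ]
      _ = ∏ _j : J, ∑ s ∈ I, ENNReal.ofReal (((s.2 : ℝ) + 2) ^ p * δ ^ s.2) := by
          rw [Finset.prod_univ_sum]
      _ ≤ ∏ _j : J, ENNReal.ofReal ((m + 1) * A) := by
          refine Finset.prod_le_prod' fun _ _ => ?_
          rw [← ENNReal.ofReal_sum_of_nonneg fun s _ => by positivity]
          apply ENNReal.ofReal_le_ofReal
          rw [hI, Finset.sum_sigma]
          calc _ ≤ ∑ t ∈ Finset.range (m + 1), A := Finset.sum_le_sum fun t _ => hA (t + 1)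
            _ = _ := by simp
      _ = _ := by simp
  calc _ ≤ P {ω | ENNReal.ofReal L ^ Fintype.card J ≤
          ∏ j, ENNReal.ofReal (gapSum p (fun i => ω ∈ Z j i) m)} := by
        refine measure_mono fun ω hω => ?_
        simp only [Set.mem_ofPred_eq] at hω ⊢
        rw [← Finset.card_univ, ← Finset.prod_const]
        exact Finset.prod_le_prod' fun j _ => ENNReal.ofReal_le_ofReal (hω j).le
    _ ≤ (∫⁻ ω, ∏ j, ENNReal.ofReal (gapSum p (fun i => ω ∈ Z j i) m) ∂P) /
          ENNReal.ofReal L ^ Fintype.card J := by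
        refine meas_ge_le_lintegral_div (Measurable.aemeasurable ?_) ?_ ?_
        · refine Finset.measurable_prod _ fun j _ => ?_
          simp_rw [hgap]
          exact Finset.measurable_sum _ fun s _ =>
            (measurable_one.indicator (hTm j s)).const_mul _
        · exact pow_ne_zero _ (by simpa using hL)
        · exact ENNReal.pow_ne_top ENNReal.ofReal_ne_top
    _ ≤ ENNReal.ofReal ((m + 1) * A) ^ Fintype.card J / ENNReal.ofReal L ^ Fintype.card J := by
        gcongr
    _ = _ := by
        rw [ENNReal.ofReal_div_of_pos hL, div_eq_mul_inv, div_eq_mul_inv, mul_pow, ENNReal.inv_pow]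

/-- The weights `(g + 2) ^ p * δ ^ g` have bounded partial sums. -/
lemma exists_sum_rpow_mul_geometric_le (p : ℝ) {δ : ℝ} (hδ : 0 ≤ δ) (hδ1 : δ < 1) :
    ∃ A : ℝ, 0 < A ∧ ∀ t : ℕ, ∑ g ∈ Finset.range t, ((g : ℝ) + 2) ^ p * δ ^ g ≤ A := by
  obtain ⟨N, hN⟩ := exists_nat_ge p
  have hs : Summable fun g : ℕ => ((g : ℝ) + 2) ^ N * δ ^ g := by
    have h0 : Summable fun g : ℕ => δ ^ g := summable_geometric_of_lt_one hδ hδ1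
    have h1 : Summable fun g : ℕ => (g : ℝ) ^ N * δ ^ g :=
      summable_pow_mul_geometric_of_norm_lt_one N (by rwa [Real.norm_eq_abs, abs_of_nonneg hδ])
    refine Summable.of_nonneg_of_le (fun g => by positivity) (fun g => ?_)
      ((h1.add h0).mul_left (3 ^ N))
    rw [← add_one_mul, ← mul_assoc]
    gcongr
    rcases Nat.eq_zero_or_pos g with rfl | hg
    · have h2 : (2 : ℝ) ^ N ≤ 3 ^ N := by gcongr; norm_num
      have h3 : (0 : ℝ) ≤ 0 ^ N := by positivity
      have h4 : (0 : ℝ) < 3 ^ N := by positivity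
      norm_num
      nlinarith
    · have hg' : (1 : ℝ) ≤ g := by exact_mod_cast hg
      calc ((g : ℝ) + 2) ^ N ≤ (3 * g) ^ N := by gcongr; linarith
        _ = 3 ^ N * (g : ℝ) ^ N := mul_pow _ _ _
        _ ≤ _ := by gcongr; linarith
  have hnn : ∀ g : ℕ, 0 ≤ ((g : ℝ) + 2) ^ N * δ ^ g := fun g => by positivity
  -- The `+ 1` gives strict positivity for free.
  refine ⟨∑' g : ℕ, ((g : ℝ) + 2) ^ N * δ ^ g + 1,
    add_pos_of_nonneg_of_pos (tsum_nonneg hnn) one_pos, fun t => ?_⟩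
  calc _ ≤ ∑ g ∈ Finset.range t, ((g : ℝ) + 2) ^ N * δ ^ g := by
        refine Finset.sum_le_sum fun g _ => ?_
        rw [← Real.rpow_natCast ((g : ℝ) + 2)]
        exact mul_le_mul_of_nonneg_right (Real.rpow_le_rpow_of_exponent_le
          (by linarith [(Nat.cast_nonneg g : (0 : ℝ) ≤ g)]) hN) (by positivity)
    _ ≤ ∑' g : ℕ, ((g : ℝ) + 2) ^ N * δ ^ g := hs.sum_le_tsum _ fun g _ => hnn g
    _ ≤ _ := by linarith

end EmptyCells

/-! ### Columns of balls around the segment. -/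

section Columns

open scoped ENNReal

/-- A grid of points around the segment from `x` to `y`: for each offset `j` a column of points
parallel to the segment, with all distances at least the mesh size `dist x y / m`. -/
theorem exists_grid_along_segment {d : ℕ} {x y : EuclideanSpace ℝ (Fin (d + 1))} (hxy : x ≠ y)
    {m : ℕ} (hm : 0 < m) (N : ℕ) {h : ℝ} (hh : h = dist x y / m) :
    ∃ c : (Fin d → Fin N) → ℕ → EuclideanSpace ℝ (Fin (d + 1)),
      (∀ j i k, i ≤ k → dist (c j i) (c j k) ≤ h * (k - i)) ∧
      (∀ j i, dist x (c j i) ≤ h * (d * N + i)) ∧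
      (∀ j, ∀ i < m, dist (c j i) y ≤ h * (d * N + (m - i))) ∧
      (∀ a b : (Fin d → Fin N) × ℕ, a ≠ b → h ≤ dist (c a.1 a.2) (c b.1 b.2)) ∧
      ∀ j, ∀ i < m, ∃ s ∈ segment ℝ x y, dist (c j i) s ≤ h * (d * N) := by
  have hD : 0 < dist x y := dist_pos.2 hxy
  have hm' : (0 : ℝ) < m := by exact_mod_cast hm
  have hh0 : 0 < h := by rw [hh]; positivity
  set D := dist x y with hDdef
  have hDm : D = h * m := by rw [hh]; field_simp
  -- The axis `b 0` points along the segment; the other `d` axes carry the column offsets.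
  obtain ⟨b, hb⟩ : ∃ b : OrthonormalBasis (Fin (d + 1)) ℝ (EuclideanSpace ℝ (Fin (d + 1))),
      D • b 0 = y - x := by
    have hon : Orthonormal ℝ (Set.domRestrict ({0} : Set (Fin (d + 1)))
        fun _ : Fin (d + 1) => D⁻¹ • (y - x)) := by
      rw [orthonormal_iff_ite]
      rintro ⟨i, hi⟩ ⟨j, hj⟩
      simp only [Set.mem_singleton_iff] at hi hj
      subst hi hj
      have : ‖y - x‖ = D := by rw [hDdef, dist_comm, dist_eq_norm]
      simp only [Set.domRestrict_apply, if_true, real_inner_self_eq_norm_sq, norm_smul, this,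
        norm_inv, Real.norm_eq_abs, abs_of_pos hD]
      rw [inv_mul_cancel₀ hD.ne', one_pow]
    obtain ⟨b, hb⟩ := hon.exists_orthonormalBasis_extension_of_card_eq (by simp)
    exact ⟨b, by rw [hb 0 rfl, smul_inv_smul₀ hD.ne']⟩
  set off : (Fin d → Fin N) → EuclideanSpace ℝ (Fin (d + 1)) := fun j =>
    h • ∑ i : Fin d, ((j i : ℕ) : ℝ) • b i.succ with hoff
  have hb1 : ∀ i, ‖b i‖ = 1 := fun i => b.orthonormal.norm_eq_one i
  have hoffn : ∀ j, ‖off j‖ ≤ h * (d * N) := by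
    intro j
    rw [hoff, norm_smul, Real.norm_eq_abs, abs_of_pos hh0]
    gcongr
    calc ‖∑ i : Fin d, ((j i : ℕ) : ℝ) • b i.succ‖
        ≤ ∑ i : Fin d, ‖((j i : ℕ) : ℝ) • b i.succ‖ := norm_sum_le _ _
      _ ≤ ∑ i : Fin d, (N : ℝ) := by
          refine Finset.sum_le_sum fun i _ => ?_
          rw [norm_smul, hb1, mul_one, Real.norm_eq_abs, Nat.abs_cast]
          exact_mod_cast (j i).2.le
      _ = _ := by simp
  have hbn : ∀ r : ℝ, ‖r • b 0‖ = |r| := fun r => by rw [norm_smul, hb1, mul_one, Real.norm_eq_abs]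
  have hy : y = x + (h * m) • b 0 := by rw [← hDm, hb]; abel
  refine ⟨fun j i => x + (h * i) • b 0 + off j, ?_, ?_, ?_, ?_, ?_⟩
  · intro j i k hik
    have hik' : (i : ℝ) ≤ k := by exact_mod_cast hik
    rw [dist_comm, dist_eq_norm]
    have : x + (h * k) • b 0 + off j - (x + (h * i) • b 0 + off j) = (h * (k - i)) • b 0 := by
      module
    rw [this, hbn, abs_of_nonneg (mul_nonneg hh0.le (by linarith))]
  · intro j i
    rw [dist_comm, dist_eq_norm]
    have : x + (h * i) • b 0 + off j - x = off j + (h * i) • b 0 := by module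
    rw [this, mul_add]
    refine (norm_add_le _ _).trans (add_le_add (hoffn j) ?_)
    rw [hbn, abs_of_nonneg (by positivity)]
  · intro j i hi
    have hi' : (i : ℝ) < m := by exact_mod_cast hi
    rw [dist_eq_norm]
    have : x + (h * i) • b 0 + off j - y = off j + (-(h * (m - i))) • b 0 := by rw [hy]; module
    rw [this, mul_add]
    refine (norm_add_le _ _).trans (add_le_add (hoffn j) ?_)
    rw [hbn, abs_neg, abs_of_nonneg (mul_nonneg hh0.le (by linarith))]
  -- Pairing with `b i` recovers a coordinate, and distinct integer vectors differ by at least 1 in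
  -- some coordinate. This separation makes the balls of radius `h / 2` disjoint.
  · have key : ∀ (a a' : Fin (d + 1) → ℝ) (i : Fin (d + 1)), 1 ≤ |a i - a' i| →
        h ≤ dist (x + h • ∑ i, a i • b i) (x + h • ∑ i, a' i • b i) := by
      intro a a' i hi
      rw [dist_add_left, dist_eq_norm, ← smul_sub, norm_smul, Real.norm_eq_abs, abs_of_pos hh0,
        ← Finset.sum_sub_distrib]
      simp_rw [← sub_smul]
      refine le_mul_of_one_le_right hh0.le (hi.trans ?_)
      have h1 := b.orthonormal.inner_right_fintype (fun i => a i - a' i) i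
      have h2 := abs_real_inner_le_norm (b i) (∑ i, (a i - a' i) • b i)
      rwa [h1, hb1, one_mul] at h2
    have hform : ∀ (j : Fin d → Fin N) (i : ℕ), x + (h * i) • b 0 + off j =
        x + h • ∑ l, (Fin.cons (i : ℝ) fun l => ((j l : ℕ) : ℝ) : Fin (d + 1) → ℝ) l • b l := by
      intro j i
      rw [Fin.sum_univ_succ]
      simp only [Fin.cons_zero, Fin.cons_succ, hoff, smul_add, smul_smul, add_assoc]
    have hnat : ∀ u v : ℕ, u ≠ v → (1 : ℝ) ≤ |(u : ℝ) - v| := by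
      intro u v huv
      have : (1 : ℤ) ≤ |(u : ℤ) - v| := Int.one_le_abs (by omega)
      exact_mod_cast this
    rintro ⟨j, i⟩ ⟨j', i'⟩ hne
    simp only [hform]
    by_cases hi : i = i'
    · have hj : j ≠ j' := fun hj => hne (by rw [hi, hj])
      obtain ⟨l, hl⟩ := Function.ne_iff.1 hj
      refine key _ _ l.succ ?_
      simp only [Fin.cons_succ]
      exact hnat _ _ fun hc => hl (Fin.ext hc)
    · refine key _ _ 0 ?_
      simp only [Fin.cons_zero]
      exact hnat _ _ hi
  · intro j i hi
    have hi' : (i : ℝ) ≤ m := by exact_mod_cast hi.le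
    refine ⟨x + (h * i) • b 0, ?_, ?_⟩
    · rw [segment_eq_image']
      refine ⟨i / m, ⟨by positivity, div_le_one_of_le₀ hi' hm'.le⟩, ?_⟩
      simp only
      rw [← hb, smul_smul, hDm]
      congr 2
      field_simp
    · rw [dist_eq_norm, add_sub_cancel_left]; exact hoffn j

variable {Ω : Type*} [MeasurableSpace Ω] {P : Measure Ω} [IsProbabilityMeasure P]

/-- With high probability some column near the segment from `x` to `y` provides a cheap path. -/
theorem measure_not_reachableWithin_le {d : ℕ} {X : ℕ → Ω → EuclideanSpace ℝ (Fin (d + 1))}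
    (hX : ∀ i, Measurable (X i)) (hind : iIndepFun X P)
    {μ : Measure (EuclideanSpace ℝ (Fin (d + 1)))} (hlaw : ∀ i, P.map (X i) = μ)
    {p : ℝ} (hp : 0 ≤ p) {x y : EuclideanSpace ℝ (Fin (d + 1))} (hxy : x ≠ y)
    {m : ℕ} (hm : 0 < m) (N n : ℕ) {h q δ A : ℝ} (hh : h = dist x y / m) (hq : 0 ≤ q)
    (hμ : ∀ c, (∃ s ∈ segment ℝ x y, dist c s ≤ h * (d * N)) →
      ENNReal.ofReal q ≤ μ (ball c (h / 2)))
    (hδ : Real.exp (-(n * q)) ≤ δ) (hA0 : 0 < A)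
    (hA : ∀ t : ℕ, ∑ g ∈ Finset.range t, ((g : ℝ) + 2) ^ p * δ ^ g ≤ A) :
    P {ω | ¬ ReachableWithin p (samplePoints X n ω ∪ {x, y}) x y
        (2 ^ p * h ^ p * (2 * ((d : ℝ) * N) ^ p + 2 * ((m + 1) * A)))}
      ≤ ENNReal.ofReal (1 / 2) ^ (N ^ d) := by
  have hh0 : 0 ≤ h := by rw [hh]; positivity
  have hδ0 : 0 ≤ δ := (Real.exp_pos _).le.trans hδ
  obtain ⟨c, hc1, hc2, hc3, hc4, hc5⟩ := exists_grid_along_segment hxy hm N hh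
  set Z : (Fin d → Fin N) → ℕ → Set Ω := fun j i =>
    {ω | ∀ a ∈ samplePoints X n ω, a ∉ ball (c j i) (h / 2)} with hZdef
  have hZm : ∀ j i, MeasurableSet (Z j i) := by
    intro j i
    have : Z j i = ⋂ k ∈ Finset.range n, X k ⁻¹' (ball (c j i) (h / 2))ᶜ := by
      ext ω
      simp [hZdef, samplePoints]
    rw [this]
    exact Finset.measurableSet_biInter _ fun k _ => hX k measurableSet_ball.compl
  have hZ : ∀ S : Finset ((Fin d → Fin N) × ℕ), (∀ a ∈ S, a.2 < m) →
      P (⋂ a ∈ S, Z a.1 a.2) ≤ ENNReal.ofReal δ ^ S.card := by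
    intro S hS
    have h1 := measure_cells_empty_le hX hind hlaw
      (B := fun a : (Fin d → Fin N) × ℕ => ball (c a.1 a.2) (h / 2))
      (fun _ => measurableSet_ball) hq S
      (fun a _ b _ hab => ball_disjoint_ball (by linarith [hc4 a b hab]))
      (fun a ha => hμ _ (hc5 a.1 a.2 (hS a ha))) n
    calc P (⋂ a ∈ S, Z a.1 a.2) ≤ _ := measure_mono fun ω hω => by
          simp only [Set.mem_iInter] at hω
          exact fun a ha => hω a ha
      _ ≤ _ := h1
      _ ≤ _ := by gcongr
  -- Twice the bound on the mean gap sum, so that each column contributes a factor `1 / 2`.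
  have hL : (0 : ℝ) < 2 * ((m + 1) * A) := by positivity
  have hmain := measure_forall_gapSum_lt_le hZm hδ0 hZ hL hA
  have hhalf : ((m : ℝ) + 1) * A / (2 * ((m + 1) * A)) = 1 / 2 := by field_simp
  rw [hhalf, Fintype.card_pi] at hmain
  simp only [Fintype.card_fin, Finset.prod_const, Finset.card_univ] at hmain
  refine (measure_mono fun ω hω j => ?_).trans hmain
  by_contra hcon
  rw [not_lt] at hcon
  refine hω ?_
  refine (reachableWithin_of_column (A := samplePoints X n ω) hp hh0
    (w := d * N) (by positivity) (hc1 j) (hc2 j) (hc3 j) ?_).mono ?_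
  · rw [hh]
    have : (0 : ℝ) < m := by exact_mod_cast hm
    field_simp
    exact le_rfl
  · have h1 : gapSum p (fun i => ∀ a ∈ samplePoints X n ω, a ∉ ball (c j i) (h / 2)) m
        ≤ 2 * ((m + 1) * A) := hcon
    gcongr

end Columns

/-! ### Bounds for long chains and the law of the sample points. -/

section TailBound

open scoped ENNReal

/-- If `y` can be reached from `x` at cost at most `c`, but no `k` distinct points of `A` form a
chain from `x` of length at most `c`, then shortest paths have at most `k` edges. -/
lemma IsShortestPath.length_le {E : Type*} [MetricSpace E] {p : ℝ} {A : Set E} {x y : E} {c : ℝ}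
    {k : ℕ} (hreach : ReachableWithin p (A ∪ {x, y}) x y c)
    (hchain : ¬ ∃ u : ℕ → E, u 0 = x ∧ (∀ j, 1 ≤ j → j ≤ k → u j ∈ A) ∧ Set.InjOn u {j | j ≤ k} ∧
      ∑ j ∈ Finset.range k, dist (u j) (u (j + 1)) ^ p ≤ c)
    {w : (⊤ : SimpleGraph E).Walk x y} (hw : IsShortestPath p A w) : w.length ≤ k := by
  by_contra! hlt
  obtain ⟨w', hw', hc⟩ := hreach
  obtain ⟨u, hu0, huA, hinj, hsum⟩ := hw.1.exists_chain (p := p) hlt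
  exact hchain ⟨u, hu0, huA, hinj, hsum.trans ((hw.powerLength_le w' hw').trans hc)⟩

variable {Ω : Type*} [MeasurableSpace Ω] {P : Measure Ω} [IsProbabilityMeasure P]

/-- In units of the typical spacing `ρ⁻¹`, chains of `k` distinct sample points have length at
least a constant times `k`, up to an exponentially small probability. -/
theorem exists_forall_measure_exists_chain_le {d : ℕ}
    {X : ℕ → Ω → EuclideanSpace ℝ (Fin (d + 1))}
    (hX : ∀ i, Measurable (X i)) (hind : iIndepFun X P)
    {μ : Measure (EuclideanSpace ℝ (Fin (d + 1)))} (hlaw : ∀ i, P.map (X i) = μ)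
    {a : ℝ} (ha : 0 ≤ a) (hμ : μ ≤ ENNReal.ofReal a • volume) {p : ℝ} (hp : 1 ≤ p) :
    ∃ τ : ℝ, 0 < τ ∧ ∀ (n k : ℕ) (ρ c : ℝ) (x : EuclideanSpace ℝ (Fin (d + 1))), 0 < ρ →
      ρ ^ (d + 1) = n * a → (τ * ρ) ^ p * c ≤ k →
      P {ω | ∃ u : ℕ → EuclideanSpace ℝ (Fin (d + 1)), u 0 = x ∧
        (∀ j, 1 ≤ j → j ≤ k → u j ∈ samplePoints X n ω) ∧ Set.InjOn u {j | j ≤ k} ∧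
        ∑ j ∈ Finset.range k, dist (u j) (u (j + 1)) ^ p ≤ c} ≤ ENNReal.ofReal (Real.exp (-k)) := by
  set I : ℝ≥0∞ :=
    ∫⁻ v : EuclideanSpace ℝ (Fin (d + 1)), ENNReal.ofReal (Real.exp (-‖v‖ ^ p)) with hI
  have hItop : I ≠ ∞ := (lintegral_exp_neg_norm_rpow_lt_top volume hp).ne
  have hI0 : 0 ≤ I.toReal := ENNReal.toReal_nonneg
  -- Makes `n` times the one-step moment at most `I / τ ≤ e⁻²`; the union bound is then `e ^ k * e ^
  -- (-2k)`. The `+ 1` ensures `1 ≤ τ`, hence `τ ≤ τ ^ (d + 1)`.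
  set τ : ℝ := Real.exp 2 * (I.toReal + 1) with hτ
  have hτ0 : 0 < τ := by positivity
  have hτ1 : 1 ≤ τ := by
    have := Real.one_le_exp (show (0 : ℝ) ≤ 2 by norm_num)
    nlinarith
  refine ⟨τ, hτ0, fun n k ρ c x hρ hρd hk => ?_⟩
  have hτρ : 0 < τ * ρ := by positivity
  have hJ : ∀ u, ∫⁻ v, ENNReal.ofReal (Real.exp (-((τ * ρ) ^ p * dist u v ^ p))) ∂μ
      ≤ ENNReal.ofReal a * (ENNReal.ofReal (((τ * ρ) ^ (d + 1))⁻¹) * I) := by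
    intro u
    refine (lintegral_mono' hμ le_rfl).trans (le_of_eq ?_)
    rw [lintegral_smul_measure, lintegral_exp_neg_dist_rpow_eq volume hτρ u]
    simp [hI]
  have hnJ : (n : ℝ≥0∞) * (ENNReal.ofReal a * (ENNReal.ofReal (((τ * ρ) ^ (d + 1))⁻¹) * I))
      ≤ ENNReal.ofReal (Real.exp (-2)) := by
    rw [← ENNReal.ofReal_toReal hItop, ← ENNReal.ofReal_natCast, ← ENNReal.ofReal_mul (by positivity),
      ← ENNReal.ofReal_mul ha, ← ENNReal.ofReal_mul (by positivity)]
    apply ENNReal.ofReal_le_ofReal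
    have h1 : (n : ℝ) * (a * (((τ * ρ) ^ (d + 1))⁻¹ * I.toReal)) = (τ ^ (d + 1))⁻¹ * I.toReal := by
      rw [mul_pow, hρd, ← mul_assoc, ← mul_assoc, mul_inv]
      have : (n : ℝ) * a ≠ 0 := by rw [← hρd]; positivity
      field_simp
      exact mul_div_cancel_left₀ _ this
    have h2 : τ ≤ τ ^ (d + 1) := le_self_pow₀ hτ1 (by omega)
    calc _ = (τ ^ (d + 1))⁻¹ * I.toReal := h1
      _ ≤ τ⁻¹ * (I.toReal + 1) := by gcongr; linarith
      _ = Real.exp (-2) := by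
          rw [hτ, mul_inv, Real.exp_neg]
          field_simp
  calc _ ≤ _ := measure_exists_chain_le hX hind hlaw (by positivity) hJ n k x
    _ ≤ ENNReal.ofReal (Real.exp k) * ENNReal.ofReal (Real.exp (-2)) ^ k := by
        gcongr
    _ = _ := by
        rw [← ENNReal.ofReal_pow (Real.exp_pos _).le, ← Real.exp_nat_mul,
          ← ENNReal.ofReal_mul (Real.exp_pos _).le, ← Real.exp_add]
        congr 2
        ring

lemma uniformBallDensity_nonneg {d : ℕ} (z : EuclideanSpace ℝ (Fin d)) (R : ℝ)
    (u : EuclideanSpace ℝ (Fin d)) : 0 ≤ uniformBallDensity z R u := by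
  unfold uniformBallDensity
  exact Set.indicator_nonneg (fun _ _ => by positivity) u

lemma withDensity_uniformBallDensity {d : ℕ} (z : EuclideanSpace ℝ (Fin d)) {R : ℝ} (hR : 0 < R) :
    (volume.withDensity fun u => ENNReal.ofReal (uniformBallDensity z R u)) =
      ENNReal.ofReal (uniformBallDensity z R z) • volume.restrict (ball z R) := by
  have h1 : (fun u => ENNReal.ofReal (uniformBallDensity z R u)) =
      (ball z R).indicator fun _ => ENNReal.ofReal (uniformBallDensity z R z) := by
    ext u
    by_cases hu : u ∈ ball z R
    · simp [uniformBallDensity, hu, hR]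
    · simp [uniformBallDensity, hu]
  rw [h1, withDensity_indicator measurableSet_ball, withDensity_const]

/-- The two error terms together decay exponentially in `T`. -/
lemma half_pow_add_exp_neg_le {M k : ℕ} {b T : ℝ} (hM : b * T ≤ M) (hk : b * T ≤ k)
    (hT : 4 ≤ b * T) :
    ENNReal.ofReal (1 / 2) ^ M + ENNReal.ofReal (Real.exp (-k))
      ≤ ENNReal.ofReal (Real.exp (-(b / 4 * T))) := by
  have h2 : (1 / 2 : ℝ) ≤ Real.exp (-(1 / 2)) := by
    have := Real.add_one_le_exp (-(1 / 2 : ℝ)); linarith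
  rw [← ENNReal.ofReal_pow (by norm_num), ← ENNReal.ofReal_add (by positivity) (by positivity)]
  apply ENNReal.ofReal_le_ofReal
  have h3 : (1 / 2 : ℝ) ^ M ≤ Real.exp (-(b * T / 2)) := by
    calc (1 / 2 : ℝ) ^ M ≤ Real.exp (-(1 / 2)) ^ M := by gcongr
      _ = Real.exp (M * (-(1 / 2))) := (Real.exp_nat_mul _ _).symm
      _ ≤ _ := Real.exp_le_exp.2 (by linarith)
  have h4 : Real.exp (-(k : ℝ)) ≤ Real.exp (-(b * T / 2)) := Real.exp_le_exp.2 (by linarith)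
  -- Half of the exponent absorbs the factor 2, because `4 ≤ b * T`.
  have h5 : 2 * Real.exp (-(b * T / 2)) ≤ Real.exp (-(b / 4 * T)) := by
    have h6 : Real.exp (-(b * T / 2)) = Real.exp (-(b / 4 * T)) * Real.exp (-(b * T / 4)) := by
      rw [← Real.exp_add]; congr 1; ring
    have h7 : Real.exp (-(b * T / 4)) ≤ 1 / 2 := by
      rw [Real.exp_neg, inv_le_comm₀ (Real.exp_pos _) (by norm_num)]
      have := Real.add_one_le_exp (b * T / 4)
      norm_num
      linarith
    rw [h6]
    nlinarith [Real.exp_pos (-(b / 4 * T))]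
  linarith

end TailBound

/-! ### Choice of constants and conclusion. -/

section Main

open scoped ENNReal

/-- Comparison of the two scales `lam ^ α * D` and `lam ^ (1 / d) * D`. -/
lemma rpow_mul_le_mul_rpow {d : ℕ} {α lam D R : ℝ} (hα1 : (d + 1 : ℝ) * α ≤ 1) (hlam : 0 < lam)
    (hD : 0 < D) (hDR : D ≤ R) :
    lam ^ α * D ≤ R ^ (1 - (d + 1 : ℝ) * α) *
      (lam ^ (1 / ((d + 1 : ℕ) : ℝ)) * D) ^ ((d + 1 : ℝ) * α) := by
  have hd : (0 : ℝ) < d + 1 := by positivity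
  rw [Real.mul_rpow (by positivity) hD.le, ← Real.rpow_mul hlam.le]
  have h1 : 1 / ((d + 1 : ℕ) : ℝ) * ((d + 1 : ℝ) * α) = α := by push_cast; field_simp
  rw [h1]
  calc lam ^ α * D = D ^ (1 - (d + 1 : ℝ) * α) * (lam ^ α * D ^ ((d + 1 : ℝ) * α)) := by
        have : D ^ (1 - (d + 1 : ℝ) * α) * D ^ ((d + 1 : ℝ) * α) = D := by
          rw [← Real.rpow_add hD]; simp
        calc _ = lam ^ α * (D ^ (1 - (d + 1 : ℝ) * α) * D ^ ((d + 1 : ℝ) * α)) := by rw [this]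
          _ = _ := by ring
    _ ≤ _ := by
        gcongr

lemma ofReal_le_uniformBall {d : ℕ} (z c : EuclideanSpace ℝ (Fin (d + 1))) {R r : ℝ} (hR : 0 < R)
    (hr : 0 < r) (h : dist c z + r ≤ R) :
    ENNReal.ofReal (uniformBallDensity z R z * r ^ (d + 1) *
        volume.real (ball (0 : EuclideanSpace ℝ (Fin (d + 1))) 1)) ≤
      (volume.withDensity fun u => ENNReal.ofReal (uniformBallDensity z R u)) (ball c r) := by
  have ha := uniformBallDensity_nonneg z R z
  rw [withDensity_uniformBallDensity z hR, Measure.smul_apply, Measure.restrict_apply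
    measurableSet_ball, Set.inter_eq_left.2 (ball_subset_ball' (by linarith)), smul_eq_mul,
    Measure.addHaar_ball_of_pos _ _ hr, finrank_euclideanSpace_fin, mul_assoc,
    ENNReal.ofReal_mul ha, ENNReal.ofReal_mul (by positivity), measureReal_def,
    ENNReal.ofReal_toReal measure_ball_lt_top.ne]

/-- The cost of a good column, measured in units of the typical spacing. -/
lemma rpow_mul_cost_le {p τ ρ h D A N r m K : ℝ} (hp : 0 ≤ p) (hτ : 0 ≤ τ) (hρ : 0 ≤ ρ)
    (hh : 0 ≤ h) (hD : 0 ≤ D) (hA : 0 ≤ A) (hN : 0 ≤ N) (hNr : N ≤ r) (hr : 0 ≤ r)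
    (hrp : r ^ p = m) (hm : 1 ≤ m) (hρh : ρ * h ≤ 1)
    (hK : τ ^ p * (2 ^ p * (2 * D ^ p + 4 * A)) ≤ K) :
    (τ * ρ) ^ p * (2 ^ p * h ^ p * (2 * (D * N) ^ p + 2 * ((m + 1) * A))) ≤ K * m := by
  -- Here `N ≤ r = m ^ (1 / p)` keeps the sideways cost linear in `m`.
  have h1 : (D * N) ^ p ≤ D ^ p * m := by
    rw [← hrp, ← Real.mul_rpow hD hr]
    gcongr
  have h2 : 2 * ((m + 1) * A) ≤ 4 * A * m := by nlinarith
  have h3 : (ρ * h) ^ p ≤ 1 := Real.rpow_le_one (by positivity) hρh hp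
  calc _ = τ ^ p * (ρ * h) ^ p * (2 ^ p * (2 * (D * N) ^ p + 2 * ((m + 1) * A))) := by
        rw [Real.mul_rpow hτ hρ, Real.mul_rpow hρ hh]; ring
    _ ≤ τ ^ p * 1 * (2 ^ p * (2 * (D ^ p * m) + 4 * A * m)) := by gcongr
    _ = τ ^ p * (2 ^ p * (2 * D ^ p + 4 * A)) * m := by ring
    _ ≤ K * m := by gcongr

variable {Ω : Type*} [MeasurableSpace Ω] {P : Measure Ω} [IsProbabilityMeasure P]

set_option maxHeartbeats 1000000 in
/-- Non-asymptotic form of the main theorem: shortest paths with too many nodes are exponentially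
unlikely in `(n f(z)) ^ α * dist x y`. -/
theorem exists_tail_bound {d : ℕ} (hd : 0 < d) {p : ℝ} (hp : 1 < p)
    (z : EuclideanSpace ℝ (Fin (d + 1))) {R₁ R₂ : ℝ} (hR₁ : 0 < R₁) (hR : R₁ < R₂)
    {α : ℝ} (hα : α = (((d + 1 : ℕ) : ℝ) + 2 * p)⁻¹)
    {X : ℕ → Ω → EuclideanSpace ℝ (Fin (d + 1))} (hX : ∀ i, Measurable (X i))
    (hind : iIndepFun X P)
    (hlaw : ∀ i, P.map (X i) =
      volume.withDensity fun u => ENNReal.ofReal (uniformBallDensity z R₂ u)) :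
    ∃ C : ℝ, 0 < C ∧ ∃ b : ℝ, 0 < b ∧ ∃ T₀ : ℝ, ∀ (n : ℕ) (x y : EuclideanSpace ℝ (Fin (d + 1))),
      x ∈ ball z R₁ → y ∈ ball z R₁ →
      T₀ ≤ ((n : ℝ) * uniformBallDensity z R₂ z) ^ α * dist x y →
      P {ω | ∀ w : (⊤ : SimpleGraph (EuclideanSpace ℝ (Fin (d + 1)))).Walk x y,
            IsShortestPath p (samplePoints X n ω) w →
              (w.support.length : ℝ) / (((n : ℝ) * uniformBallDensity z R₂ z) ^
                (1 / ((d + 1 : ℕ) : ℝ)) * dist x y) ≤ C}ᶜ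
        ≤ ENNReal.ofReal (Real.exp (-(b * (((n : ℝ) * uniformBallDensity z R₂ z) ^ α *
            dist x y)))) := by
  have hp0 : 0 < p := by linarith
  have hR₂ : 0 < R₂ := by linarith
  have hd' : (1 : ℝ) ≤ d := by exact_mod_cast hd
  set a : ℝ := uniformBallDensity z R₂ z with ha
  have ha0 : 0 ≤ a := uniformBallDensity_nonneg z R₂ z
  set v : ℝ := volume.real (ball (0 : EuclideanSpace ℝ (Fin (d + 1))) 1) with hv
  have hv0 : 0 < v :=
    ENNReal.toReal_pos (measure_ball_pos _ _ one_pos).ne' measure_ball_lt_top.ne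
  set δ : ℝ := Real.exp (-((1 / 4) ^ (d + 1) * v)) with hδ
  have hδ1 : δ < 1 := by
    rw [hδ, Real.exp_lt_one_iff]
    have : 0 < (1 / 4 : ℝ) ^ (d + 1) * v := by positivity
    linarith
  obtain ⟨A, hA0, hA⟩ := exists_sum_rpow_mul_geometric_le p (Real.exp_pos _).le hδ1
  obtain ⟨τ, hτ0, hτ⟩ := exists_forall_measure_exists_chain_le hX hind hlaw ha0
    (by rw [withDensity_uniformBallDensity z hR₂]
        exact smul_le_smul_left _ Measure.restrict_le_self) hp.le
  set κ : ℝ := (d + 1 : ℝ) * α with hκ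
  have hκeq : κ = (d + 1) / (d + 1 + 2 * p) := by rw [hκ, hα]; push_cast; ring
  have hκ0 : 0 < κ := by rw [hκeq]; positivity
  have hκ1 : κ ≤ 1 := by
    rw [hκeq, div_le_one (by positivity)]; linarith
  -- This needs `1 ≤ d`, that is, ambient dimension at least 2.
  have hκd : κ ≤ d / p := by
    rw [hκeq, div_le_div_iff₀ (by positivity) hp0]
    nlinarith
  set B : ℝ := (2 * R₁) ^ (1 - κ) with hB
  have hB0 : 0 < B := by positivity
  -- Keeps the half-width `h * (d * N)` of the tube below `(R₂ - R₁) / 2`.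
  set ε : ℝ := min 1 ((R₂ - R₁) / (4 * d * R₁)) with hε
  have hRR : 0 < R₂ - R₁ := by linarith
  have hε0 : 0 < ε := lt_min one_pos (by positivity)
  have hε1 : ε ≤ 1 := min_le_left _ _
  have hε2 : ε * (4 * d * R₁) ≤ R₂ - R₁ :=
    (le_div_iff₀ (by positivity)).1 (min_le_right _ _)
  set C₁ : ℝ := 2 ^ p * (2 * (d : ℝ) ^ p + 4 * A) with hC₁
  have hC₁0 : 0 < C₁ := by positivity
  set K : ℕ := ⌈τ ^ p * C₁⌉₊ + 1 with hK
  have hKle : τ ^ p * C₁ ≤ K := by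
    rw [hK]; push_cast; linarith [Nat.le_ceil (τ ^ p * C₁)]
  -- Threshold for `s`: the entries give `m ≤ 2 * s`, a loss of at most half when rounding `ε * r`
  -- down to `N`, and `h ≤ R₂ - R₁`.
  set M₀ : ℝ := max 1 (max ((2 / ε) ^ p) (2 * R₁ / (R₂ - R₁))) with hM₀
  have hM₀1 : 1 ≤ M₀ := le_max_left _ _
  set b₀ : ℝ := min ((ε / 2) ^ d / B) (1 / B) with hb₀
  have hb₀0 : 0 < b₀ := lt_min (by positivity) (by positivity)
  -- At most `K * m` edges means at most `K * m + 1 ≤ (K + 1) * m ≤ 2 * (K + 1) * s` nodes. The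
  -- threshold on `T` forces `M₀ ≤ s` and `4 ≤ b₀ * T`.
  refine ⟨2 * (K + 1), by positivity, b₀ / 4, by positivity, max (B * M₀ ^ κ) (4 / b₀), ?_⟩
  intro n x y hx hy hT₀
  set T : ℝ := ((n : ℝ) * a) ^ α * dist x y with hT
  have hT1 : B * M₀ ^ κ ≤ T := (le_max_left _ _).trans hT₀
  have hT2 : 4 ≤ b₀ * T := by
    have := (le_max_right _ _).trans hT₀
    rwa [div_le_iff₀ hb₀0, mul_comm] at this
  have hTpos : 0 < T := lt_of_lt_of_le (by positivity) hT1
  have hα0 : α ≠ 0 := by rw [hα]; positivity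
  have hlam : 0 < (n : ℝ) * a := by
    refine lt_of_le_of_ne (by positivity) fun h0 => hTpos.ne' ?_
    rw [hT, ← h0, Real.zero_rpow hα0, zero_mul]
  have hD : 0 < dist x y := by
    refine lt_of_le_of_ne dist_nonneg fun h0 => hTpos.ne' ?_
    rw [hT, ← h0, mul_zero]
  have hxz : dist x z < R₁ := hx
  have hyz : dist y z < R₁ := hy
  have hDR : dist x y ≤ 2 * R₁ := by
    linarith [dist_triangle_right x y z]
  have hTs := rpow_mul_le_mul_rpow (d := d) (α := α) hκ1 hlam hD hDR
  set ρ : ℝ := ((n : ℝ) * a) ^ (1 / ((d + 1 : ℕ) : ℝ)) with hρ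
  have hρ0 : 0 < ρ := by positivity
  have hρd : ρ ^ (d + 1) = n * a := by
    rw [hρ, one_div]
    exact Real.rpow_inv_natCast_pow hlam.le (by omega)
  set s : ℝ := ρ * dist x y with hs
  have hs0 : 0 < s := by positivity
  rw [← hT, ← hκ, ← hB] at hTs
  have hsM : M₀ ≤ s := by
    have := le_of_mul_le_mul_left (hT1.trans hTs) hB0
    exact (Real.rpow_le_rpow_iff (by positivity) hs0.le hκ0).1 this
  have hs1 : 1 ≤ s := hM₀1.trans hsM
  set m : ℕ := ⌈s⌉₊ with hm
  have hsm : s ≤ m := Nat.le_ceil s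
  have hms : (m : ℝ) ≤ 2 * s := by
    have := (Nat.ceil_lt_add_one hs0.le).le
    linarith
  have hm1 : (1 : ℝ) ≤ m := hs1.trans hsm
  have hm0 : 0 < m := by exact_mod_cast (lt_of_lt_of_le one_pos hm1)
  set h : ℝ := dist x y / m with hh
  have hh0 : 0 < h := by positivity
  have hρh : ρ * h = s / m := by rw [hh, hs]; ring
  have hρh1 : ρ * h ≤ 1 := by rw [hρh]; exact div_le_one_of_le₀ hsm (by positivity)
  have hρh2 : 1 / 2 ≤ ρ * h := by
    rw [hρh, le_div_iff₀ (by positivity)]; linarith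
  have hhm : h * m = dist x y := by rw [hh]; field_simp
  set r : ℝ := (m : ℝ) ^ (1 / p) with hr
  have hr0 : 0 < r := by positivity
  have hrp : r ^ p = m := by
    rw [hr, ← Real.rpow_mul (by positivity), one_div_mul_cancel hp0.ne', Real.rpow_one]
  have hrm : r ≤ m := by
    rw [hr]
    calc (m : ℝ) ^ (1 / p) ≤ (m : ℝ) ^ (1 : ℝ) :=
          Real.rpow_le_rpow_of_exponent_le hm1 (by rw [div_le_one hp0]; exact hp.le)
      _ = m := Real.rpow_one _
  have hεr : 2 ≤ ε * r := by
    have h1 : (2 / ε) ^ p ≤ r ^ p := by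
      rw [hrp]
      exact ((le_max_left _ _).trans (le_max_right _ _)).trans (hsM.trans hsm)
    have h2 := (Real.rpow_le_rpow_iff (by positivity) hr0.le hp0).1 h1
    rwa [div_le_iff₀ hε0, mul_comm] at h2
  set N : ℕ := ⌊ε * r⌋₊ with hN
  have hN1 : (N : ℝ) ≤ ε * r := Nat.floor_le (by positivity)
  have hN2 : ε / 2 * r ≤ N := by
    have := Nat.lt_floor_add_one (ε * r)
    linarith
  have hNr : (N : ℝ) ≤ r := hN1.trans (mul_le_of_le_one_left hr0.le hε1)
  -- the tube of columns stays inside the ball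
  have hwidth : h * (d * N) ≤ (R₂ - R₁) / 2 := by
    calc h * (d * N) ≤ h * (d * (ε * m)) := by
          gcongr; exact hN1.trans (by gcongr)
      _ = d * ε * (h * m) := by ring
      _ ≤ d * ε * (2 * R₁) := by rw [hhm]; gcongr
      _ ≤ _ := by linarith
  have hhalf : h / 2 ≤ (R₂ - R₁) / 2 := by
    have h1 : 2 * R₁ / (R₂ - R₁) ≤ m :=
      ((le_max_right _ _).trans (le_max_right _ _)).trans (hsM.trans hsm)
    rw [div_le_iff₀ hRR] at h1
    have h2 : h ≤ R₂ - R₁ := by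
      rw [hh, div_le_iff₀ (by positivity)]; linarith
    linarith
  have hcell : ∀ c, (∃ u ∈ segment ℝ x y, dist c u ≤ h * (d * N)) →
      ENNReal.ofReal (a * (h / 2) ^ (d + 1) * v) ≤
        (volume.withDensity fun u => ENNReal.ofReal (uniformBallDensity z R₂ u))
          (ball c (h / 2)) := by
    rintro c ⟨u, hu, hcu⟩
    refine ofReal_le_uniformBall z c hR₂ (by positivity) ?_
    have h1 : dist u z < R₁ := (convex_ball z R₁).segment_subset hx hy hu
    linarith [dist_triangle c u z]
  -- `m ≤ 2 * s` gives `ρ * h / 2 ≥ 1 / 4`: a cell has a mean number of points bounded below,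
  -- uniformly in `n`.
  have hδn : Real.exp (-(n * (a * (h / 2) ^ (d + 1) * v))) ≤ δ := by
    rw [hδ, Real.exp_le_exp, neg_le_neg_iff]
    have h1 : (n : ℝ) * (a * (h / 2) ^ (d + 1) * v) = (ρ * h / 2) ^ (d + 1) * v := by
      rw [mul_div_assoc, mul_pow, hρd]; ring
    have h2 : 1 / 4 ≤ ρ * h / 2 := by linarith
    rw [h1]
    gcongr
  have hbad1 := measure_not_reachableWithin_le hX hind hlaw hp0.le (dist_pos.1 hD) hm0 N n hh
    (by positivity) hcell hδn hA0 hA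
  set c₀ : ℝ := 2 ^ p * h ^ p * (2 * ((d : ℝ) * N) ^ p + 2 * ((m + 1) * A)) with hc₀
  have hcost : (τ * ρ) ^ p * c₀ ≤ (K * m : ℕ) := by
    push_cast
    exact rpow_mul_cost_le hp0.le hτ0.le hρ0.le hh0.le (by positivity) hA0.le (by positivity)
      hNr hr0.le hrp hm1 hρh1 hKle
  have hbad2 := hτ n (K * m) ρ c₀ x hρ0 hρd hcost
  have hM : b₀ * T ≤ (N ^ d : ℕ) := by
    have h1 : s ^ κ ≤ (m : ℝ) ^ (d / p : ℝ) :=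
      (Real.rpow_le_rpow_of_exponent_le hs1 hκd).trans (by gcongr)
    have h2 : (m : ℝ) ^ (d / p : ℝ) = r ^ d := by
      rw [hr, ← Real.rpow_natCast, ← Real.rpow_mul (by positivity)]; congr 1; ring
    calc b₀ * T ≤ (ε / 2) ^ d / B * (B * s ^ κ) := by
          gcongr; exact min_le_left _ _
      _ = (ε / 2) ^ d * s ^ κ := by field_simp
      _ ≤ (ε / 2) ^ d * r ^ d := by rw [← h2]; gcongr
      _ = (ε / 2 * r) ^ d := (mul_pow _ _ _).symm
      _ ≤ (N : ℝ) ^ d := by gcongr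
      _ = _ := by push_cast; rfl
  have hk : b₀ * T ≤ (K * m : ℕ) := by
    calc b₀ * T ≤ 1 / B * (B * s ^ κ) := by
          gcongr; exact min_le_right _ _
      _ = s ^ κ := by field_simp
      _ ≤ s ^ (1 : ℝ) := Real.rpow_le_rpow_of_exponent_le hs1 hκ1
      _ = s := Real.rpow_one s
      _ ≤ 1 * m := by linarith
      _ ≤ K * m := by
          gcongr
          rw [hK]; push_cast; linarith [(Nat.cast_nonneg ⌈τ ^ p * C₁⌉₊ : (0 : ℝ) ≤ _)]
      _ = _ := by push_cast; rfl
  refine le_trans ?_ (half_pow_add_exp_neg_le hM hk hT2)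
  refine le_trans (measure_mono ?_) ((measure_union_le _ _).trans (add_le_add hbad1 hbad2))
  intro ω hω
  by_contra hcon
  rw [Set.mem_union, not_or] at hcon
  obtain ⟨hc1, hc2⟩ := hcon
  refine hω fun w hw => ?_
  have hlen := hw.length_le (not_not.1 hc1) hc2
  rw [SimpleGraph.Walk.length_support, div_le_iff₀ hs0]
  have hlen' : (w.length : ℝ) ≤ K * m := by exact_mod_cast hlen
  push_cast
  have hK0 : (0 : ℝ) ≤ K := Nat.cast_nonneg K
  nlinarith

end Main

theorem mainTheorem8 {d : ℕ} (hd : 1 < d) {p : ℝ} (hp : 1 < p)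
    {Ω : Type*} [MeasurableSpace Ω] (P : Measure Ω) [IsProbabilityMeasure P]
    (z : EuclideanSpace ℝ (Fin d)) (R₁ R₂ : ℝ) (hR₁ : 0 < R₁) (hR : R₁ < R₂)
    (α : ℝ) (hα : α = ((d : ℝ) + 2 * p)⁻¹)
    (f : EuclideanSpace ℝ (Fin d) → ℝ) (hf : f = uniformBallDensity z R₂)
    (X : ℕ → Ω → EuclideanSpace ℝ (Fin d)) (hXmeas : ∀ i, Measurable (X i))
    (hXindep : iIndepFun X P)
    (hXlaw : ∀ i, P.map (X i) = volume.withDensity fun u => ENNReal.ofReal (f u))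
    (x y : ℕ → EuclideanSpace ℝ (Fin d))
    (hx : ∀ n, x n ∈ ball z R₁) (hy : ∀ n, y n ∈ ball z R₁)
    (hxy : Tendsto (fun n : ℕ => ((n : ℝ) * f z) ^ α * dist (x n) (y n)) atTop atTop) :
    ∃ C : ℝ, 0 < C ∧
      limsup (fun n : ℕ =>
        ((1 / (((n : ℝ) * f z) ^ α * dist (x n) (y n)) : ℝ) : EReal) *
          ENNReal.log (P {ω | ∀ w : (⊤ : SimpleGraph (EuclideanSpace ℝ (Fin d))).Walk (x n) (y n),
            IsShortestPath p (samplePoints X n ω) w →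
              (w.support.length : ℝ) / (((n : ℝ) * f z) ^ (1 / (d : ℝ)) * dist (x n) (y n)) ≤ C}ᶜ))
        atTop < 0 := by
  -- One dimension runs along the segment, `d'` are transverse.
  obtain ⟨d, rfl⟩ : ∃ d', d = d' + 1 := ⟨d - 1, by omega⟩
  subst hf
  obtain ⟨C, hC, b, hb, T₀, hT₀⟩ :=
    exists_tail_bound (by omega) hp z hR₁ hR hα hXmeas hXindep hXlaw
  refine ⟨C, hC, lt_of_le_of_lt (b := ((-b : ℝ) : EReal)) ?_ (by exact_mod_cast neg_lt_zero.2 hb)⟩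
  refine limsup_le_of_le (by isBoundedDefault) ?_
  filter_upwards [hxy.eventually_ge_atTop T₀, hxy.eventually_gt_atTop 0] with n h1 h2
  set T : ℝ := ((n : ℝ) * uniformBallDensity z R₂ z) ^ α * dist (x n) (y n) with hT
  have h3 := ENNReal.log_monotone (hT₀ n (x n) (y n) (hx n) (hy n) h1)
  rw [ENNReal.log_ofReal_of_pos (Real.exp_pos _), Real.log_exp] at h3
  have h4 : (0 : EReal) ≤ ((1 / T : ℝ) : EReal) := by
    exact_mod_cast (by positivity : 0 ≤ 1 / T)
  refine (mul_le_mul_of_nonneg_left h3 h4).trans (le_of_eq ?_)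
  rw [← EReal.coe_mul]
  congr 1
  rw [← hT]
  field_simp
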